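/- Let $G$ be a compact Hausdorff topological group with normalized Haar measure $\mu$ (the regular Haar probability measure on the Borel sets of $G$), and let $L^2(G)=L^2(G,\mu)$ consist of complex-valued functions. Vector spaces are complex, and inner products $\langle\cdot,\cdot\rangle$ on representation spaces are linear in the first variable. A unitary representation of $G$ on a Hilbert space $H$ is a homomorphism $\pi$ from $G$ to the unitary group of $H$ such that $x\mapsto\pi(x)v$ is continuous for every $v\in H$; it is irreducible if $H\neq 0$ and the only closed invariant subspaces are $0$ and $H$. For $v,w\in H$ the matrix coefficient $\varphi^{\pi}_{v,w}\in C(G)$ is $\varphi^{\pi}_{v,w}(x)=\langle\pi(x)v,w\rangle$. Let $\mathcal A(G)\subseteq C(G)$ be the complex linear span of all matrix coefficients of all finite-dimensional unitary representations of $G$, and let $\widehat G$ be the unitary dual, the set of unitary equivalence classes of irreducible unitary representations of $G$ on Hilbert spaces. 1. Every continuous representation of $G$ on a finite-dimensional complex vector space is equivalent (by an invertible linear intertwining map) to a unitary representation on a finite-dimensional Hilbert space. 2. $\mathcal A(G)$ is a $*$-subalgebra of $C(G)$ (for pointwise operations and complex conjugation), contains the constants, separates the points of $G$, and is uniformly dense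 in $C(G)$. 3. Every irreducible unitary representation of $G$ on a Hilbert space is finite-dimensional. Choose, in any way, a representative $\pi$ on $H_\pi$ of each class in $\widehat G$ and an orthonormal basis $e^{\pi}_1,\dots,e^{\pi}_{d_\pi}$ of $H_\pi$, where $d_\pi=\dim H_\pi$. Then the functions $\sqrt{d_\pi}\,\varphi^{\pi}_{e^{\pi}_i,e^{\pi}_j}$ ($\pi\in\widehat G$, $1\le i,j\le d_\pi$) form an orthonormal basis of $L^2(G)$. 4. For every choice of representatives as in 3 there is a unitary isomorphism $$\widehat{\bigoplus}_{\pi\in\widehat G} H_\pi\otimes H_\pi^{*}\;\cong\; L^2(G)$$ from the Hilbert direct sum (where $H_\pi^*$ is the dual Hilbert space and $H_\pi\otimes H_\pi^*$ the Hilbert space tensor product) onto $L^2(G)$ that sends $v\otimes\langle\cdot,w\rangle$ in the summand of $\pi$ to $\sqrt{d_\pi}\,\varphi^{\pi}_{v,w}$, for all $v,w\in H_\pi$. -/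

import Mathlib

open MeasureTheory
open scoped TensorProduct InnerProductSpace

universe u v

/-- A (strongly continuous) unitary representation of a topological group `G` on a complex inner
product space `H`: a homomorphism into the group of surjective linear isometries of `H` all of
whose orbit maps are continuous. If `H` is finite-dimensional this is the same as a continuous
homomorphism into the unitary group of `H`. -/
structure UnitaryRep (G : Type u) [Group G] [TopologicalSpace G]
    (H : Type v) [NormedAddCommGroup H] [InnerProductSpace ℂ H] where
  toHom : G →* (H ≃ₗᵢ[ℂ] H)
  continuous_apply : ∀ v : H, Continuous fun g : G => toHom g v

namespace UnitaryRep

variable {G : Type u} [Group G] [TopologicalSpace G]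
variable {H : Type v} [NormedAddCommGroup H] [InnerProductSpace ℂ H]

/-- Irreducibility: `H` is nonzero and its only closed invariant subspaces are `0` and `H`. -/
def IsIrreducible (π : UnitaryRep G H) : Prop :=
  Nontrivial H ∧ ∀ K : Submodule ℂ H, IsClosed (K : Set H) →
    (∀ g : G, ∀ v ∈ K, π.toHom g v ∈ K) → K = ⊥ ∨ K = ⊤

/-- Unitary equivalence. -/
def UnitaryEquiv {H' : Type v} [NormedAddCommGroup H'] [InnerProductSpace ℂ H']
    (π : UnitaryRep G H) (π' : UnitaryRep G H') : Prop :=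
  ∃ T : H ≃ₗᵢ[ℂ] H', ∀ (g : G) (v : H), T (π.toHom g v) = π'.toHom g (T v)

/-- The matrix coefficient `x ↦ ⟨π(x)v, w⟩`, where `⟨·,·⟩` is linear in its first variable
(Mathlib's inner product is linear in the second one). -/
noncomputable def matrixCoeff (π : UnitaryRep G H) (v w : H) : C(G, ℂ) where
  toFun x := inner ℂ w (π.toHom x v)
  continuous_toFun := continuous_const.inner (π.continuous_apply v)

end UnitaryRep

/-- The complex linear span of all matrix coefficients of all finite-dimensional continuous
unitary representations of `G`. -/
noncomputable def matrixCoeffSpan (G : Type u) [Group G] [TopologicalSpace G] : Submodule ℂ C(G, ℂ) :=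
  Submodule.span ℂ {f | ∃ (V : Type v) (_ : NormedAddCommGroup V) (_ : InnerProductSpace ℂ V)
    (_ : FiniteDimensional ℂ V) (π : UnitaryRep G V) (a b : V), f = π.matrixCoeff a b}

/-- An irreducible unitary representation of `G` on some complex Hilbert space. -/
structure IrredUnitaryRep (G : Type u) [Group G] [TopologicalSpace G] where
  space : Type v
  [normed : NormedAddCommGroup space]
  [innerProd : InnerProductSpace ℂ space]
  [complete : CompleteSpace space]
  rep : UnitaryRep G space
  irreducible : rep.IsIrreducible

attribute [instance] IrredUnitaryRep.normed IrredUnitaryRep.innerProd IrredUnitaryRep.complete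

instance irredUnitaryRepSetoid (G : Type u) [Group G] [TopologicalSpace G] :
    Setoid (IrredUnitaryRep.{u, v} G) where
  r σ τ := σ.rep.UnitaryEquiv τ.rep
  iseqv :=
    { refl := fun _ => ⟨LinearIsometryEquiv.refl ℂ _, fun _ _ => rfl⟩
      symm := by
        rintro σ τ ⟨T, hT⟩
        refine ⟨T.symm, fun g w => ?_⟩
        rw [LinearIsometryEquiv.symm_apply_eq, hT, LinearIsometryEquiv.apply_symm_apply]
      trans := by
        rintro σ τ ρ ⟨T, hT⟩ ⟨S, hS⟩
        refine ⟨T.trans S, fun g w => ?_⟩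
        simp [hT, hS] }

/-- The unitary dual of `G`: unitary equivalence classes of irreducible unitary representations
of `G` on complex Hilbert spaces. -/
def UnitaryDual (G : Type u) [Group G] [TopologicalSpace G] : Type (max u (v + 1)) :=
  Quotient (irredUnitaryRepSetoid.{u, v} G)

/-- The class of an irreducible unitary representation in the unitary dual. -/
def IrredUnitaryRep.toUnitaryDual {G : Type u} [Group G] [TopologicalSpace G]
    (σ : IrredUnitaryRep.{u, v} G) : UnitaryDual.{u, v} G :=
  Quotient.mk (irredUnitaryRepSetoid.{u, v} G) σ

/-- The Hilbert space structure of the dual `H*` of a Hilbert space `H` (for the operator norm):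
`⟨φ_v, φ_w⟩ = ⟨w, v⟩` if `φ_v`, `φ_w` are the functionals represented by `v`, `w`. -/
noncomputable instance strongDualInnerProductSpace (H : Type v) [NormedAddCommGroup H]
    [InnerProductSpace ℂ H] [CompleteSpace H] : InnerProductSpace ℂ (StrongDual ℂ H) where
  inner φ ψ := inner ℂ ((InnerProductSpace.toDual ℂ H).symm ψ)
    ((InnerProductSpace.toDual ℂ H).symm φ)
  norm_sq_eq_re_inner φ := by
    rw [inner_self_eq_norm_sq, LinearIsometryEquiv.norm_map]
  conj_inner_symm φ ψ := inner_conj_symm _ _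
  add_left φ ψ χ := by rw [map_add, inner_add_right]
  smul_left φ ψ r := by rw [map_smulₛₗ, inner_smul_right]
/-!
Everything rests on one compactness argument. For a vector `a` of a unitary representation `π`, the
average `T` of the rank-one operators `⟨·, π(x)a⟩ π(x)a` over the group is compact, self-adjoint and
commutes with `π`, so its eigenspaces for nonzero eigenvalues are finite-dimensional and invariant.
A vector `a` orthogonal to all finite-dimensional invariant subspaces is therefore killed by `T`,
and `⟨Ta, a⟩ = ∫ |⟨a, π(x)a⟩|² dx` forces `a = 0`. Hence finite-dimensional invariant subspaces span
a dense subspace of every unitary representation. Irreducible representations are thus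
finite-dimensional, and, since the regular representation on `L²(G)` is faithful, matrix
coefficients separate points, so that the Stone–Weierstrass theorem applies. The Schur orthogonality
relations come from Schur's lemma applied to the same averages, for `⟨·, π(x)a⟩ π'(x)a'`.
-/

universe w

lemma integrable_of_continuous {X E : Type*} [TopologicalSpace X] [CompactSpace X]
    [MeasurableSpace X] [OpensMeasurableSpace X] {μ : Measure X} [IsFiniteMeasureOnCompacts μ]
    [NormedAddCommGroup E] {f : X → E} (hf : Continuous f) : Integrable f μ :=
  hf.integrable_of_hasCompactSupport (HasCompactSupport.of_compactSpace f)

namespace UnitaryRep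

section Constructions

variable {G : Type u} [Group G] [TopologicalSpace G]
variable {H : Type v} [NormedAddCommGroup H] [InnerProductSpace ℂ H]
variable {H' : Type w} [NormedAddCommGroup H'] [InnerProductSpace ℂ H']

/-- The unitary representation given by a linear representation by isometries with continuous orbit
maps. -/
noncomputable def ofRepresentation (ρ : Representation ℂ G H) (hnorm : ∀ g a, ‖ρ g a‖ = ‖a‖)
    (hcont : ∀ a, Continuous fun g => ρ g a) : UnitaryRep G H where
  toHom :=
    { toFun g := LinearIsometryEquiv.ofSurjective ⟨ρ g, hnorm g⟩ fun b =>
        ⟨ρ g⁻¹ b, ρ.self_inv_apply g b⟩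
      map_one' := by ext a; exact LinearMap.congr_fun ρ.map_one a
      map_mul' g h := by ext a; exact LinearMap.congr_fun (ρ.map_mul g h) a }
  continuous_apply := hcont

@[simp]
lemma matrixCoeff_apply (π : UnitaryRep G H) (a b : H) (x : G) :
    π.matrixCoeff a b x = inner ℂ b (π.toHom x a) := rfl

lemma toHom_mul_apply (π : UnitaryRep G H) (g h : G) (a : H) :
    π.toHom (g * h) a = π.toHom g (π.toHom h a) := by simp

lemma inner_toHom_left (π : UnitaryRep G H) (g : G) (a b : H) :
    inner ℂ (π.toHom g a) b = inner ℂ a (π.toHom g⁻¹ b) := by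
  rw [← (π.toHom g⁻¹).inner_map_map, ← toHom_mul_apply]
  simp

lemma inner_toHom_right (π : UnitaryRep G H) (g : G) (a b : H) :
    inner ℂ a (π.toHom g b) = inner ℂ (π.toHom g⁻¹ a) b := by
  rw [inner_toHom_left, inv_inv]

/-- The matrix coefficient as a function of its two vectors, linear in the first and
conjugate-linear in the second one. -/
noncomputable def matrixCoeffₛₗ (π : UnitaryRep G H) : H →ₗ[ℂ] H →ₗ⋆[ℂ] C(G, ℂ) :=
  LinearMap.mk₂'ₛₗ _ _ π.matrixCoeff
    (fun _ _ _ => by ext; simp) (fun _ _ _ => by ext; simp)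
    (fun _ _ _ => by ext; simp) (fun _ _ _ => by ext; simp [mul_comm])

@[simp]
lemma matrixCoeffₛₗ_apply (π : UnitaryRep G H) (a b : H) :
    π.matrixCoeffₛₗ a b = π.matrixCoeff a b := rfl

/-- The trivial representation. -/
def trivial (G : Type u) [Group G] [TopologicalSpace G] (H : Type v) [NormedAddCommGroup H]
    [InnerProductSpace ℂ H] : UnitaryRep G H where
  toHom := 1
  continuous_apply _ := continuous_const

/-- The transport of a unitary representation along a surjective isometry. The isometry may be
conjugate-linear, which gives the dual representation on `StrongDual ℂ H`. -/
noncomputable def transport {σ σ' : ℂ →+* ℂ} [RingHomInvPair σ σ'] [RingHomInvPair σ' σ]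
    (π : UnitaryRep G H) (e : H ≃ₛₗᵢ[σ] H') : UnitaryRep G H' where
  toHom :=
    { toFun g := (e.symm.trans (π.toHom g)).trans e
      map_one' := by ext; simp
      map_mul' g h := by ext; simp }
  continuous_apply a := e.continuous.comp (π.continuous_apply (e.symm a))

@[simp]
lemma transport_apply {σ σ' : ℂ →+* ℂ} [RingHomInvPair σ σ'] [RingHomInvPair σ' σ]
    (π : UnitaryRep G H) (e : H ≃ₛₗᵢ[σ] H') (g : G) (a : H') :
    (π.transport e).toHom g a = e (π.toHom g (e.symm a)) := rfl

lemma matrixCoeff_transport_toDual [CompleteSpace H] (π : UnitaryRep G H) (a b : H) :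
    (π.transport (InnerProductSpace.toDual ℂ H)).matrixCoeff (InnerProductSpace.toDual ℂ H a)
      (InnerProductSpace.toDual ℂ H b) = star (π.matrixCoeff a b) := by
  ext x
  change inner ℂ ((InnerProductSpace.toDual ℂ H).symm _)
    ((InnerProductSpace.toDual ℂ H).symm (InnerProductSpace.toDual ℂ H b)) = _
  simp

/-- The tensor product of two unitary representations. -/
noncomputable def tensor (π : UnitaryRep G H) (π' : UnitaryRep G H') :
    UnitaryRep G (H ⊗[ℂ] H') where
  toHom :=
    { toFun g := TensorProduct.congrIsometry (π.toHom g) (π'.toHom g)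
      map_one' := by rw [map_one, map_one]; exact TensorProduct.congrIsometry_refl_refl
      map_mul' g h := by
        rw [map_mul, map_mul]
        ext x
        exact LinearMap.congr_fun (TensorProduct.map_mul (π.toHom g).toLinearEquiv.toLinearMap
          (π.toHom h).toLinearEquiv.toLinearMap (π'.toHom g).toLinearEquiv.toLinearMap
          (π'.toHom h).toLinearEquiv.toLinearMap) x }
  continuous_apply x := by
    induction x with
    | zero => simpa using continuous_const
    | add x y hx hy => simpa only [map_add] using! hx.add hy
    | tmul a b =>
      exact TensorProduct.continuous_tmul.comp
        ((π.continuous_apply a).prodMk (π'.continuous_apply b))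

lemma matrixCoeff_tensor (π : UnitaryRep G H) (π' : UnitaryRep G H') (a b : H) (a' b' : H') :
    (π.tensor π').matrixCoeff (a ⊗ₜ a') (b ⊗ₜ b') = π.matrixCoeff a b * π'.matrixCoeff a' b' := by
  ext x
  exact TensorProduct.inner_tmul (𝕜 := ℂ) b (π.toHom x a) b' (π'.toHom x a')

end Constructions

section Invariant

variable {G : Type u} [Group G] [TopologicalSpace G]
variable {H : Type v} [NormedAddCommGroup H] [InnerProductSpace ℂ H]

/-- The invariant subspaces of a unitary representation; as `G` is a group, `π(g)K ⊆ K` suffices. -/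
def IsInvariant (π : UnitaryRep G H) (K : Submodule ℂ H) : Prop :=
  ∀ g : G, ∀ a ∈ K, π.toHom g a ∈ K

lemma IsInvariant.orthogonal {π : UnitaryRep G H} {K : Submodule ℂ H} (hK : π.IsInvariant K) :
    π.IsInvariant Kᗮ := fun g a ha b hb => by
  rw [inner_toHom_right]
  exact ha _ (hK _ _ hb)

/-- The restriction of a unitary representation to an invariant subspace. -/
noncomputable def restrict (π : UnitaryRep G H) (K : Submodule ℂ H) (hK : π.IsInvariant K) :
    UnitaryRep G K :=
  ofRepresentation
    { toFun g := (π.toHom g).toLinearEquiv.toLinearMap.restrict (hK g)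
      map_one' := by ext; simp
      map_mul' g h := by ext a; exact toHom_mul_apply π g h a }
    (fun g a => (π.toHom g).norm_map a)
    (fun a => (π.continuous_apply (a : H)).subtype_mk fun g => hK g a a.2)

@[simp]
lemma coe_restrict_apply (π : UnitaryRep G H) (K : Submodule ℂ H) (hK : π.IsInvariant K)
    (g : G) (a : K) : ((π.restrict K hK).toHom g a : H) = π.toHom g a := rfl

lemma matrixCoeff_restrict (π : UnitaryRep G H) (K : Submodule ℂ H) (hK : π.IsInvariant K)
    (a b : K) : (π.restrict K hK).matrixCoeff a b = π.matrixCoeff a b := by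
  ext x; simp

lemma matrixCoeff_add_add_of_mem_orthogonal {π : UnitaryRep G H} {K : Submodule ℂ H}
    (hK : π.IsInvariant K) {a b a' b' : H} (ha : a ∈ K) (hb : b ∈ K) (ha' : a' ∈ Kᗮ)
    (hb' : b' ∈ Kᗮ) :
    π.matrixCoeff (a + a') (b + b') = π.matrixCoeff a b + π.matrixCoeff a' b' := by
  ext x
  have h₁ : inner ℂ b (π.toHom x a') = 0 := hK.orthogonal x a' ha' b hb
  have h₂ : inner ℂ b' (π.toHom x a) = 0 :=
    Submodule.inner_left_of_mem_orthogonal (hK x a ha) hb'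
  simp [h₁, h₂]

/-- The sum of all finite-dimensional invariant subspaces: the space of `G`-finite vectors. -/
def finiteVectors (π : UnitaryRep G H) : Submodule ℂ H :=
  sSup {K | FiniteDimensional ℂ K ∧ π.IsInvariant K}

lemma IsInvariant.le_finiteVectors {π : UnitaryRep G H} {K : Submodule ℂ H}
    [hfin : FiniteDimensional ℂ K] (hK : π.IsInvariant K) : K ≤ π.finiteVectors :=
  le_sSup ⟨hfin, hK⟩

lemma exists_isInvariant_of_not_isIrreducible [Nontrivial H] {π : UnitaryRep G H}
    (hπ : ¬ π.IsIrreducible) :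
    ∃ K : Submodule ℂ H, π.IsInvariant K ∧ K ≠ ⊥ ∧ K ≠ ⊤ := by
  by_contra! h
  exact hπ ⟨‹_›, fun K _ hK => or_iff_not_imp_left.2 (h K hK)⟩

end Invariant

section Intertwining

variable {G : Type u} [Group G] [TopologicalSpace G]
variable {H : Type v} [NormedAddCommGroup H] [InnerProductSpace ℂ H]
variable {H' : Type w} [NormedAddCommGroup H'] [InnerProductSpace ℂ H']
variable {π : UnitaryRep G H} {π' : UnitaryRep G H'}

/-- The linear maps that commute with the actions of two unitary representations. -/
def IsIntertwining (π : UnitaryRep G H) (π' : UnitaryRep G H') (T : H →ₗ[ℂ] H') : Prop :=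
  ∀ g a, T (π.toHom g a) = π'.toHom g (T a)

namespace IsIntertwining

lemma isInvariant_range {T : H →ₗ[ℂ] H'} (hT : IsIntertwining π π' T) :
    π'.IsInvariant T.range := by
  rintro g _ ⟨a, rfl⟩
  exact ⟨π.toHom g a, hT g a⟩

lemma isInvariant_eigenspace {T : H →ₗ[ℂ] H} (hT : IsIntertwining π π T) (c : ℂ) :
    π.IsInvariant (Module.End.eigenspace T c) := fun g a ha => by
  rw [Module.End.mem_eigenspace_iff] at ha ⊢
  rw [hT, ha, map_smul]

lemma adjoint [FiniteDimensional ℂ H] [FiniteDimensional ℂ H'] {T : H →ₗ[ℂ] H'}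
    (hT : IsIntertwining π π' T) : IsIntertwining π' π T.adjoint := fun g b => by
  refine ext_inner_left ℂ fun a => ?_
  rw [LinearMap.adjoint_inner_right, inner_toHom_right, ← hT, inner_toHom_right,
    LinearMap.adjoint_inner_right]

lemma orthogonal_finiteVectors_le_ker [CompleteSpace H] {T : H →L[ℂ] H}
    (hT : IsIntertwining π π T) (hcomp : IsCompactOperator T)
    (hsymm : (T : H →ₗ[ℂ] H).IsSymmetric) : π.finiteVectorsᗮ ≤ (T : H →ₗ[ℂ] H).ker := by
  intro a ha
  rw [LinearMap.mem_ker, ← Submodule.mem_bot ℂ,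
    ← ContinuousLinearMap.orthogonalComplement_iSup_eigenspaces_eq_bot hcomp hsymm,
    ← Submodule.iInf_orthogonal, Submodule.mem_iInf]
  intro c b hb
  rw [← hsymm, Module.End.mem_eigenspace_iff.1 hb, inner_smul_left]
  rcases eq_or_ne c 0 with rfl | hc
  · simp
  · have := T.finite_dimensional_eigenspace hcomp c hc
    rw [ha b ((hT.isInvariant_eigenspace c).le_finiteVectors hb), mul_zero]

end IsIntertwining

lemma matrixCoeff_map_of_isIntertwining (T : H ≃ₗᵢ[ℂ] H')
    (hT : IsIntertwining π π' T.toLinearEquiv.toLinearMap) (a b : H) :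
    π'.matrixCoeff (T a) (T b) = π.matrixCoeff a b := by
  ext x
  rw [matrixCoeff_apply, matrixCoeff_apply, ← T.inner_map_map]
  exact congrArg _ (hT x a).symm

lemma matrixCoeff_transport (π : UnitaryRep G H) (e : H ≃ₗᵢ[ℂ] H') (a b : H) :
    (π.transport e).matrixCoeff (e a) (e b) = π.matrixCoeff a b :=
  matrixCoeff_map_of_isIntertwining e (fun g a => by simp) a b

end Intertwining

section Schur

variable {G : Type u} [Group G] [TopologicalSpace G]
variable {H : Type v} [NormedAddCommGroup H] [InnerProductSpace ℂ H] [FiniteDimensional ℂ H]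
variable {π : UnitaryRep G H}

namespace IsIrreducible

lemma eq_bot_or_eq_top (hπ : π.IsIrreducible) {K : Submodule ℂ H} (hK : π.IsInvariant K) :
    K = ⊥ ∨ K = ⊤ :=
  hπ.2 K K.closed_of_finiteDimensional hK

theorem exists_eq_smul_id (hπ : π.IsIrreducible) {T : H →ₗ[ℂ] H} (hT : IsIntertwining π π T) :
    ∃ c : ℂ, T = c • LinearMap.id := by
  have := hπ.1
  obtain ⟨c, hc⟩ := Module.End.exists_eigenvalue T
  have htop := (hπ.eq_bot_or_eq_top (hT.isInvariant_eigenspace c)).resolve_left hc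
  exact ⟨c, LinearMap.ext fun a => Module.End.mem_eigenspace_iff.1 (htop ▸ Submodule.mem_top)⟩

variable {H' : Type v} [NormedAddCommGroup H'] [InnerProductSpace ℂ H'] [FiniteDimensional ℂ H']
variable {π' : UnitaryRep G H'}

lemma exists_norm_map_eq_mul (hπ : π.IsIrreducible) {T : H →ₗ[ℂ] H'}
    (hT : IsIntertwining π π' T) : ∃ r : ℝ, 0 ≤ r ∧ ∀ a, ‖T a‖ = r * ‖a‖ := by
  -- Schur's lemma for the self-intertwining map `T† T`
  obtain ⟨c, hc⟩ := hπ.exists_eq_smul_id (T := T.adjoint ∘ₗ T) fun g a => by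
    rw [LinearMap.comp_apply, hT, hT.adjoint, LinearMap.comp_apply]
  refine ⟨√‖c‖, Real.sqrt_nonneg _, fun a => ?_⟩
  have hsq : ((‖T a‖ : ℂ)) ^ 2 = c * (‖a‖ : ℂ) ^ 2 := by
    have hinner := congrArg (inner ℂ a) (LinearMap.congr_fun hc a)
    rwa [LinearMap.comp_apply, LinearMap.adjoint_inner_right, LinearMap.smul_apply,
      LinearMap.id_apply, inner_smul_right, inner_self_eq_norm_sq_to_K,
      inner_self_eq_norm_sq_to_K] at hinner
  have hnorm : ‖T a‖ ^ 2 = ‖c‖ * ‖a‖ ^ 2 := by simpa using congrArg norm hsq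
  rw [← Real.sqrt_sq (norm_nonneg (T a)), hnorm, Real.sqrt_mul (norm_nonneg c),
    Real.sqrt_sq (norm_nonneg a)]

theorem unitaryEquiv_of_ne_zero (hπ : π.IsIrreducible) (hπ' : π'.IsIrreducible) {T : H →ₗ[ℂ] H'}
    (hT : IsIntertwining π π' T) (hT₀ : T ≠ 0) : π.UnitaryEquiv π' := by
  obtain ⟨r, hr, hnorm⟩ := hπ.exists_norm_map_eq_mul hT
  have hr₀ : r ≠ 0 := by
    rintro rfl
    exact hT₀ (LinearMap.ext fun a => by simpa using hnorm a)
  have hsurj : Function.Surjective T := LinearMap.range_eq_top.1 <|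
    (hπ'.eq_bot_or_eq_top hT.isInvariant_range).resolve_left (mt LinearMap.range_eq_bot.1 hT₀)
  let S : H →ₗᵢ[ℂ] H' :=
    { toLinearMap := (r : ℂ)⁻¹ • T
      norm_map' a := by simp [norm_smul, hnorm, abs_of_nonneg hr, hr₀] }
  have hS : Function.Surjective S := fun b => by
    obtain ⟨a, rfl⟩ := hsurj b
    refine ⟨(r : ℂ) • a, ?_⟩
    change (r : ℂ)⁻¹ • T ((r : ℂ) • a) = T a
    rw [map_smul, inv_smul_smul₀ (by exact_mod_cast hr₀)]
  refine ⟨LinearIsometryEquiv.ofSurjective S hS, fun g a => ?_⟩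
  simp [S, hT g a]

end IsIrreducible

end Schur

section Averaging

variable {G : Type u} [Group G] [TopologicalSpace G]
variable {H : Type v} [NormedAddCommGroup H] [InnerProductSpace ℂ H]
variable {H' : Type w} [NormedAddCommGroup H'] [InnerProductSpace ℂ H']

lemma continuous_rankOne (π : UnitaryRep G H) (π' : UnitaryRep G H') (a : H) (a' : H') :
    Continuous fun x => InnerProductSpace.rankOne ℂ (π'.toHom x a') (π.toHom x a) :=
  (ContinuousLinearMap.smulRightL ℂ H H').continuous₂.comp
    (((innerSL ℂ).continuous.comp (π.continuous_apply a)).prodMk (π'.continuous_apply a'))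

variable [MeasurableSpace G]

/-- The average over the group of the rank-one operators `⟨·, π(x)a⟩ π'(x)a'`. Its matrix
coefficients are the `L²` inner products of those of `π` and `π'`. -/
noncomputable def averageRankOne (μ : Measure G) (π : UnitaryRep G H) (π' : UnitaryRep G H')
    (a : H) (a' : H') : H →L[ℂ] H' :=
  ∫ x, InnerProductSpace.rankOne ℂ (π'.toHom x a') (π.toHom x a) ∂μ

variable [CompactSpace G] [BorelSpace G] (μ : Measure G) [IsFiniteMeasure μ]

lemma averageRankOne_apply (π : UnitaryRep G H) (π' : UnitaryRep G H') (a : H) (a' : H') (b : H) :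
    averageRankOne μ π π' a a' b = ∫ x, inner ℂ (π.toHom x a) b • π'.toHom x a' ∂μ :=
  ContinuousLinearMap.integral_apply
    (integrable_of_continuous (continuous_rankOne π π' a a')) b

variable [CompleteSpace H']

lemma inner_averageRankOne_apply (π : UnitaryRep G H) (π' : UnitaryRep G H') (a : H) (a' : H')
    (b : H) (b' : H') :
    inner ℂ b' (averageRankOne μ π π' a a' b) =
      ∫ x, inner ℂ (π.toHom x a) b * inner ℂ b' (π'.toHom x a') ∂μ := by
  have hintegrable : Integrable (fun x => inner ℂ (π.toHom x a) b • π'.toHom x a') μ :=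
    integrable_of_continuous
      (((π.continuous_apply a).inner continuous_const).smul (π'.continuous_apply a'))
  simp only [averageRankOne_apply, ← integral_inner hintegrable, inner_smul_right]

lemma isCompactOperator_averageRankOne (π : UnitaryRep G H) (π' : UnitaryRep G H') (a : H)
    (a' : H') : IsCompactOperator (averageRankOne μ π π' a a') := by
  let S : Submodule ℂ (H →L[ℂ] H') := compactOperator (RingHom.id ℂ) H H'
  have hrank (x : G) : InnerProductSpace.rankOne ℂ (π'.toHom x a') (π.toHom x a) ∈ S := by
    rw [InnerProductSpace.rankOne_def']
    exact (isCompactOperator_of_locallyCompactSpace_rng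
      (ContinuousLinearMap.toSpanSingleton ℂ (π'.toHom x a'))).comp_clm _
  have hclosed : IsClosed (S : Set (H →L[ℂ] H')) := isClosed_setOfPred_isCompactOperator
  have hintegrable := integrable_of_continuous (μ := μ) (continuous_rankOne π π' a a')
  rcases eq_zero_or_neZero μ with rfl | hμ
  · rw [averageRankOne, integral_zero_measure]
    exact isCompactOperator_zero
  · rw [averageRankOne, ← measure_smul_average]
    exact ((S.restrictScalars ℝ).convex.average_mem hclosed (.of_forall hrank) hintegrable).smul _

lemma isSymmetric_averageRankOne [CompleteSpace H] (π : UnitaryRep G H) (a : H) :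
    (averageRankOne μ π π a a : H →ₗ[ℂ] H).IsSymmetric := fun b c => by
  rw [← inner_conj_symm, ContinuousLinearMap.coe_coe, inner_averageRankOne_apply,
    inner_averageRankOne_apply, ← integral_conj]
  simp [mul_comm]

lemma eq_zero_of_averageRankOne_apply_self_eq_zero [μ.IsOpenPosMeasure] [CompleteSpace H]
    {π : UnitaryRep G H} {a : H} (ha : averageRankOne μ π π a a a = 0) : a = 0 := by
  have hsq (x : G) : inner ℂ (π.toHom x a) a * inner ℂ a (π.toHom x a) =
      ((‖(inner ℂ (π.toHom x a) a : ℂ)‖ ^ 2 : ℝ) : ℂ) := by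
    rw [← inner_conj_symm a, RCLike.mul_conj]
    simp
  have hcont : Continuous fun x => ‖(inner ℂ (π.toHom x a) a : ℂ)‖ ^ 2 :=
    ((π.continuous_apply a).inner continuous_const).norm.pow 2
  have hzero : ∫ x, ‖(inner ℂ (π.toHom x a) a : ℂ)‖ ^ 2 ∂μ = 0 := by
    have := inner_averageRankOne_apply μ π π a a a a
    simp only [ha, inner_zero_right, hsq, integral_complex_ofReal] at this
    exact_mod_cast this.symm
  by_contra hne
  exact (hcont.integral_pos_of_hasCompactSupport_nonneg_nonzero (μ := μ) (x := 1)
    (HasCompactSupport.of_compactSpace _) (fun _ => by positivity) (by simpa using hne)).ne' hzero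

lemma isIntertwining_averageRankOne [IsTopologicalGroup G] [μ.IsMulLeftInvariant]
    (π : UnitaryRep G H) (π' : UnitaryRep G H') (a : H) (a' : H') :
    IsIntertwining π π' (averageRankOne μ π π' a a' : H →ₗ[ℂ] H') := fun g b => by
  simp only [ContinuousLinearMap.coe_coe, averageRankOne_apply]
  rw [← integral_mul_left_eq_self _ g]
  refine Eq.trans ?_ ((π'.toHom g).toLinearIsometry.integral_comp_comm _)
  simp

end Averaging

section FiniteVectors

variable {G : Type u} [Group G] [TopologicalSpace G] [IsTopologicalGroup G] [CompactSpace G]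
variable {H : Type v} [NormedAddCommGroup H] [InnerProductSpace ℂ H] [CompleteSpace H]

theorem orthogonal_finiteVectors (π : UnitaryRep G H) : π.finiteVectorsᗮ = ⊥ := by
  borelize G
  refine (Submodule.eq_bot_iff _).2 fun a ha => ?_
  exact eq_zero_of_averageRankOne_apply_self_eq_zero (Measure.haar : Measure G) <|
    (isIntertwining_averageRankOne _ π π a a).orthogonal_finiteVectors_le_ker
      (isCompactOperator_averageRankOne _ π π a a) (isSymmetric_averageRankOne _ π a) ha

theorem topologicalClosure_finiteVectors (π : UnitaryRep G H) :
    π.finiteVectors.topologicalClosure = ⊤ :=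
  Submodule.topologicalClosure_eq_top_iff.2 π.orthogonal_finiteVectors

theorem IsIrreducible.finiteDimensional {π : UnitaryRep G H} (hπ : π.IsIrreducible) :
    FiniteDimensional ℂ H := by
  have := hπ.1
  by_contra hfin
  have hbot : π.finiteVectors = ⊥ := by
    refine sSup_eq_bot.2 fun K ⟨hK, hinv⟩ => ?_
    refine (hπ.2 K K.closed_of_finiteDimensional hinv).resolve_right ?_
    rintro rfl
    exact hfin (Module.Finite.equiv Submodule.topEquiv)
  have htop_eq_bot := π.orthogonal_finiteVectors
  rw [hbot, Submodule.bot_orthogonal_eq_top] at htop_eq_bot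
  exact top_ne_bot htop_eq_bot

end FiniteVectors

section Regular

variable {G : Type u} [Group G] [TopologicalSpace G] [IsTopologicalGroup G] [CompactSpace G]
  [MeasurableSpace G] [BorelSpace G] (μ : Measure G) [μ.IsMulLeftInvariant] [μ.Regular]
variable (E : Type v) [NormedAddCommGroup E] [InnerProductSpace ℂ E]

/-- The left regular representation on the square-integrable functions with values in `E`. -/
noncomputable def regular : UnitaryRep G (Lp E 2 μ) :=
  ofRepresentation
    { toFun g :=
        { toFun f := DomMulAct.mk g⁻¹ • f
          map_add' := smul_add _
          map_smul' c f := smul_comm _ c f }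
      map_one' := by ext1 f; simp
      map_mul' g h := by
        ext1 f
        change DomMulAct.mk (g * h)⁻¹ • f = DomMulAct.mk g⁻¹ • DomMulAct.mk h⁻¹ • f
        rw [smul_smul, mul_inv_rev, DomMulAct.mk_mul] }
    (fun g f => DomMulAct.norm_smul_Lp _ _)
    (fun f => by
      have : Fact ((2 : ENNReal) ≠ ⊤) := ⟨by simp⟩
      exact (DomMulAct.continuous_mk.comp continuous_inv).smul continuous_const)

variable {E} [SecondCountableTopologyEither G E]

lemma regular_toLp (g : G) (f : C(G, E)) :
    (regular μ E).toHom g (ContinuousMap.toLp 2 μ ℂ f) =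
      ContinuousMap.toLp 2 μ ℂ (f.comp (ContinuousMap.mulLeft g⁻¹)) := by
  refine Lp.ext ((DomMulAct.smul_Lp_ae_eq (DomMulAct.mk g⁻¹) _).trans ?_)
  exact ((measurePreserving_mul_left μ g⁻¹).quasiMeasurePreserving.ae_eq_comp
    (ContinuousMap.coeFn_toLp μ f)).trans
    (ContinuousMap.coeFn_toLp μ (f.comp (ContinuousMap.mulLeft g⁻¹))).symm

theorem toHom_regular_injective [T2Space G] [μ.IsOpenPosMeasure] :
    Function.Injective (regular μ ℂ).toHom := by
  rw [injective_iff_map_eq_one]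
  intro g hg
  by_contra hne
  obtain ⟨f, hf₀, hf₁, -⟩ := exists_continuous_zero_one_of_isClosed
    (isClosed_singleton (x := (1 : G))) (isClosed_singleton (x := g⁻¹)) (by simpa using hne)
  let F : C(G, ℂ) := ⟨fun x => (f x : ℂ), by fun_prop⟩
  have htoLp := regular_toLp μ g F
  rw [hg] at htoLp
  have heq := DFunLike.congr_fun (ContinuousMap.toLp_injective (p := 2) μ (𝕜 := ℂ) htoLp) 1
  simp [F, hf₀ (Set.mem_singleton 1), hf₁ (Set.mem_singleton g⁻¹)] at heq

end Regular

section Unitarization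

variable {G : Type u} [Group G] [TopologicalSpace G]

/-- Isometric coordinates on a finite-dimensional Hilbert space. The index type is lifted so that
unitary representations can be moved to any universe. -/
noncomputable def euclideanCoordinates (H : Type*) [NormedAddCommGroup H] [InnerProductSpace ℂ H]
    [FiniteDimensional ℂ H] :
    H ≃ₗᵢ[ℂ] EuclideanSpace ℂ (ULift.{v} (Fin (Module.finrank ℂ H))) :=
  ((stdOrthonormalBasis ℂ H).reindex Equiv.ulift.symm).repr

variable {V : Type*} [AddCommGroup V] [Module ℂ V]

lemma exists_unitaryRep_of_injective [FiniteDimensional ℂ V] {L : Type*} [NormedAddCommGroup L]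
    [InnerProductSpace ℂ L]
    {ρ : Representation ℂ G V} {π : UnitaryRep G L} {J : V →ₗ[ℂ] L} (hJ : Function.Injective J)
    (hequiv : ∀ g a, J (ρ g a) = π.toHom g (J a)) :
    ∃ (H : Type v) (_ : NormedAddCommGroup H) (_ : InnerProductSpace ℂ H)
      (_ : FiniteDimensional ℂ H) (π' : UnitaryRep G H) (T : V ≃ₗ[ℂ] H),
      ∀ (g : G) (a : V), T (ρ g a) = π'.toHom g (T a) := by
  have hinv : π.IsInvariant J.range := by
    rintro g _ ⟨a, rfl⟩
    exact ⟨ρ g a, hequiv g a⟩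
  let e := euclideanCoordinates.{v} J.range
  refine ⟨_, _, _, inferInstance, (π.restrict J.range hinv).transport e,
    (LinearEquiv.ofInjective J hJ).trans e.toLinearEquiv, fun g a => ?_⟩
  have hrange : LinearEquiv.ofInjective J hJ (ρ g a) =
      (π.restrict J.range hinv).toHom g (LinearEquiv.ofInjective J hJ a) :=
    Subtype.ext (hequiv g a)
  simp [hrange]

variable [IsTopologicalGroup G] [TopologicalSpace V]
variable {E : Type*} [NormedAddCommGroup E] [NormedSpace ℂ E]

/-- The embedding of a representation into vector-valued functions on the group that sends `a` to
`x ↦ e (ρ(x⁻¹)a)`. -/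
def orbitMap (ρ : Representation ℂ G V) (hρ : ∀ a, Continuous fun g => ρ g a)
    (e : V →L[ℂ] E) : V →ₗ[ℂ] C(G, E) where
  toFun a := ⟨fun x => e (ρ x⁻¹ a), e.continuous.comp ((hρ a).comp continuous_inv)⟩
  map_add' a b := by ext; simp
  map_smul' c a := by ext; simp

lemma orbitMap_injective {ρ : Representation ℂ G V} (hρ : ∀ a, Continuous fun g => ρ g a)
    {e : V →L[ℂ] E} (he : Function.Injective e) : Function.Injective (orbitMap ρ hρ e) :=
  fun a b hab => he (by simpa [orbitMap] using DFunLike.congr_fun hab 1)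

lemma orbitMap_apply_apply (ρ : Representation ℂ G V) (hρ : ∀ a, Continuous fun g => ρ g a)
    (e : V →L[ℂ] E) (g : G) (a : V) :
    orbitMap ρ hρ e (ρ g a) = (orbitMap ρ hρ e a).comp (ContinuousMap.mulLeft g⁻¹) := by
  ext x
  simp [orbitMap]

theorem exists_unitaryRep [CompactSpace G] [FiniteDimensional ℂ V] [IsTopologicalAddGroup V]
    [ContinuousSMul ℂ V] [T2Space V] (ρ : Representation ℂ G V)
    (hρ : ∀ a : V, Continuous fun g : G => ρ g a) :
    ∃ (H : Type v) (_ : NormedAddCommGroup H) (_ : InnerProductSpace ℂ H)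
      (_ : FiniteDimensional ℂ H) (π : UnitaryRep G H) (T : V ≃L[ℂ] H),
      ∀ (g : G) (a : V), T (ρ g a) = π.toHom g (T a) := by
  borelize G
  let μ : Measure G := Measure.haar
  let e : V ≃L[ℂ] EuclideanSpace ℂ (Fin (Module.finrank ℂ V)) :=
    ContinuousLinearEquiv.ofFinrankEq (by simp)
  have hJ := (ContinuousMap.toLp_injective (p := 2) μ (𝕜 := ℂ)).comp
    (orbitMap_injective hρ (e := e.toContinuousLinearMap) e.injective)
  obtain ⟨H, _, _, _, π, T, hT⟩ := exists_unitaryRep_of_injective.{u, v} (ρ := ρ)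
    (π := regular μ (EuclideanSpace ℂ (Fin (Module.finrank ℂ V))))
    (J := (ContinuousMap.toLp 2 μ ℂ).toLinearMap ∘ₗ orbitMap ρ hρ e.toContinuousLinearMap) hJ
    fun g a => by
      rw [LinearMap.comp_apply, orbitMap_apply_apply]
      exact (regular_toLp μ g _).symm
  exact ⟨H, _, _, ‹_›, π, T.toContinuousLinearEquiv, hT⟩

end Unitarization

section MatrixCoeffSpan

variable {G : Type u} [Group G] [TopologicalSpace G]

lemma matrixCoeff_mem_matrixCoeffSpan {H : Type*} [NormedAddCommGroup H] [InnerProductSpace ℂ H]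
    [FiniteDimensional ℂ H] (π : UnitaryRep G H) (a b : H) :
    π.matrixCoeff a b ∈ matrixCoeffSpan.{u, v} G := by
  rw [← π.matrixCoeff_transport (euclideanCoordinates.{v} H)]
  exact Submodule.subset_span ⟨_, _, _, inferInstance, _, _, _, rfl⟩

lemma matrixCoeffSpan_mul_le :
    matrixCoeffSpan.{u, v} G * matrixCoeffSpan.{u, v} G ≤ matrixCoeffSpan.{u, v} G := by
  conv_lhs => rw [matrixCoeffSpan, Submodule.span_mul_span]
  rw [Submodule.span_le]
  rintro _ ⟨_, ⟨V, _, _, _, π, a, b, rfl⟩, _, ⟨V', _, _, _, π', a', b', rfl⟩, rfl⟩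
  change π.matrixCoeff a b * π'.matrixCoeff a' b' ∈ matrixCoeffSpan G
  rw [← matrixCoeff_tensor]
  exact matrixCoeff_mem_matrixCoeffSpan _ _ _

lemma star_mem_matrixCoeffSpan {f : C(G, ℂ)} (hf : f ∈ matrixCoeffSpan.{u, v} G) :
    star f ∈ matrixCoeffSpan.{u, v} G := by
  induction hf using Submodule.span_induction with
  | mem f hf =>
    obtain ⟨V, _, _, _, π, a, b, rfl⟩ := hf
    have := FiniteDimensional.complete ℂ V
    have : FiniteDimensional ℂ (StrongDual ℂ V) := inferInstance
    exact π.matrixCoeff_transport_toDual a b ▸ matrixCoeff_mem_matrixCoeffSpan _ _ _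
  | zero => simp
  | add g h _ _ hg hh => rw [star_add]; exact add_mem hg hh
  | smul c g _ hg => rw [star_smul]; exact Submodule.smul_mem _ _ hg

lemma one_mem_matrixCoeffSpan : (1 : C(G, ℂ)) ∈ matrixCoeffSpan.{u, v} G := by
  have hone : (trivial G ℂ).matrixCoeff 1 1 = 1 := by
    ext x
    simp [trivial]
  exact hone ▸ matrixCoeff_mem_matrixCoeffSpan _ _ _

variable (G) in
/-- The span of the matrix coefficients of the finite-dimensional unitary representations, as a
star subalgebra of `C(G, ℂ)`. -/
noncomputable def matrixCoeffStarSubalgebra : StarSubalgebra ℂ C(G, ℂ) where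
  carrier := matrixCoeffSpan.{u, v} G
  mul_mem' hf hg := matrixCoeffSpan_mul_le (Submodule.mul_mem_mul hf hg)
  add_mem' := add_mem
  algebraMap_mem' c := by
    rw [Algebra.algebraMap_eq_smul_one]
    exact Submodule.smul_mem _ _ one_mem_matrixCoeffSpan
  star_mem' := star_mem_matrixCoeffSpan

@[simp]
lemma coe_matrixCoeffStarSubalgebra :
    (matrixCoeffStarSubalgebra.{u, v} G : Set C(G, ℂ)) = matrixCoeffSpan.{u, v} G := rfl

lemma toHom_eq_of_forall_mem_matrixCoeffSpan [IsTopologicalGroup G] [CompactSpace G]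
    {H : Type*} [NormedAddCommGroup H] [InnerProductSpace ℂ H] [CompleteSpace H]
    (π : UnitaryRep G H) {x y : G} (hxy : ∀ f ∈ matrixCoeffSpan.{u, v} G, f x = f y) :
    π.toHom x = π.toHom y := by
  let X : H →L[ℂ] H := (π.toHom x).toLinearIsometry.toContinuousLinearMap
  let Y : H →L[ℂ] H := (π.toHom y).toLinearIsometry.toContinuousLinearMap
  have hfinite : π.finiteVectors ≤ LinearMap.eqLocus X.toLinearMap Y.toLinearMap := by
    refine sSup_le fun K ⟨_, hinv⟩ a ha => ?_
    suffices (π.restrict K hinv).toHom x ⟨a, ha⟩ = (π.restrict K hinv).toHom y ⟨a, ha⟩ from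
      congrArg Subtype.val this
    exact ext_inner_left ℂ fun b =>
      hxy _ ((π.restrict K hinv).matrixCoeff_mem_matrixCoeffSpan ⟨a, ha⟩ b)
  have hclosure := Submodule.topologicalClosure_minimal _ hfinite
    (isClosed_eq X.continuous Y.continuous)
  rw [topologicalClosure_finiteVectors] at hclosure
  ext a
  exact hclosure (Submodule.mem_top : a ∈ ⊤)

variable [IsTopologicalGroup G] [CompactSpace G] [T2Space G]

theorem separatesPoints_matrixCoeffStarSubalgebra :
    (matrixCoeffStarSubalgebra.{u, v} G).toSubalgebra.SeparatesPoints := by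
  borelize G
  intro x y hne
  by_contra! hsep
  exact hne <| toHom_regular_injective (Measure.haar : Measure G) <|
    toHom_eq_of_forall_mem_matrixCoeffSpan _ fun f hf => hsep _ ⟨f, hf, rfl⟩

theorem dense_matrixCoeffSpan : Dense (matrixCoeffSpan.{u, v} G : Set C(G, ℂ)) := by
  have htop := ContinuousMap.starSubalgebra_topologicalClosure_eq_top_of_separatesPoints
    (matrixCoeffStarSubalgebra.{u, v} G) separatesPoints_matrixCoeffStarSubalgebra
  rw [← coe_matrixCoeffStarSubalgebra, dense_iff_closure_eq,
    ← StarSubalgebra.topologicalClosure_coe, htop, StarSubalgebra.coe_top]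

end MatrixCoeffSpan

section Irreducible

variable {G : Type u} [Group G] [TopologicalSpace G]

theorem matrixCoeff_mem_span_irreducible {H : Type v} [NormedAddCommGroup H]
    [InnerProductSpace ℂ H] [FiniteDimensional ℂ H] (π : UnitaryRep G H) (a b : H) :
    π.matrixCoeff a b ∈ Submodule.span ℂ
      {f | ∃ (σ : IrredUnitaryRep.{u, v} G) (c d : σ.space), f = σ.rep.matrixCoeff c d} := by
  induction hn : Module.finrank ℂ H using Nat.strong_induction_on generalizing H with
  | _ n ih =>
  have := FiniteDimensional.complete ℂ H
  by_cases hirr : π.IsIrreducible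
  · exact Submodule.subset_span ⟨⟨H, π, hirr⟩, a, b, rfl⟩
  rcases subsingleton_or_nontrivial H with hsub | hnt
  · rw [Subsingleton.elim a 0, ← matrixCoeffₛₗ_apply, map_zero]
    exact Submodule.zero_mem _
  obtain ⟨K, hK, hbot, htop⟩ := exists_isInvariant_of_not_isIrreducible hirr
  have hlt : Module.finrank ℂ K < n := hn ▸ Submodule.finrank_lt htop
  have hlt' : Module.finrank ℂ Kᗮ < n :=
    hn ▸ Submodule.finrank_lt (by rwa [Ne, Submodule.orthogonal_eq_top_iff])
  obtain ⟨a₁, ha₁, a₂, ha₂, rfl⟩ := K.exists_add_mem_mem_orthogonal a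
  obtain ⟨b₁, hb₁, b₂, hb₂, rfl⟩ := K.exists_add_mem_mem_orthogonal b
  rw [matrixCoeff_add_add_of_mem_orthogonal hK ha₁ hb₁ ha₂ hb₂]
  refine add_mem ?_ ?_
  · simpa only [matrixCoeff_restrict] using ih _ hlt (π.restrict K hK) ⟨a₁, ha₁⟩ ⟨b₁, hb₁⟩ rfl
  · simpa only [matrixCoeff_restrict] using
      ih _ hlt' (π.restrict Kᗮ hK.orthogonal) ⟨a₂, ha₂⟩ ⟨b₂, hb₂⟩ rfl

end Irreducible

section Orthogonality

variable {G : Type u} [Group G] [TopologicalSpace G] [CompactSpace G] [MeasurableSpace G]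
  [BorelSpace G] (μ : Measure G)
variable {H : Type v} [NormedAddCommGroup H] [InnerProductSpace ℂ H]

lemma inner_toLp_matrixCoeff [IsFiniteMeasure μ] {H' : Type w} [NormedAddCommGroup H']
    [InnerProductSpace ℂ H'] [CompleteSpace H'] (π : UnitaryRep G H) (π' : UnitaryRep G H')
    (a b : H) (a' b' : H') :
    inner ℂ (ContinuousMap.toLp 2 μ ℂ (π.matrixCoeff a b))
      (ContinuousMap.toLp 2 μ ℂ (π'.matrixCoeff a' b')) =
      inner ℂ b' (averageRankOne μ π π' a a' b) := by
  rw [ContinuousMap.inner_toLp, inner_averageRankOne_apply]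
  simp [mul_comm]

theorem inner_toLp_matrixCoeff_of_not_unitaryEquiv [IsTopologicalGroup G] [IsFiniteMeasure μ]
    [μ.IsMulLeftInvariant] {H' : Type v} [NormedAddCommGroup H'] [InnerProductSpace ℂ H']
    [FiniteDimensional ℂ H] [FiniteDimensional ℂ H'] {π : UnitaryRep G H} {π' : UnitaryRep G H'}
    (hπ : π.IsIrreducible) (hπ' : π'.IsIrreducible) (h : ¬ π.UnitaryEquiv π')
    (a b : H) (a' b' : H') :
    inner ℂ (ContinuousMap.toLp 2 μ ℂ (π.matrixCoeff a b))
      (ContinuousMap.toLp 2 μ ℂ (π'.matrixCoeff a' b')) = 0 := by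
  have := FiniteDimensional.complete ℂ H'
  have hzero : (averageRankOne μ π π' a a' : H →ₗ[ℂ] H') = 0 := by
    by_contra hne
    exact h (hπ.unitaryEquiv_of_ne_zero hπ' (isIntertwining_averageRankOne μ π π' a a') hne)
  rw [inner_toLp_matrixCoeff, ← ContinuousLinearMap.coe_coe, hzero, LinearMap.zero_apply,
    inner_zero_right]

variable [IsProbabilityMeasure μ] [FiniteDimensional ℂ H]

lemma trace_averageRankOne (π : UnitaryRep G H) (a a' : H) :
    LinearMap.trace ℂ H (averageRankOne μ π π a a') = inner ℂ a a' := by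
  have := FiniteDimensional.complete ℂ H
  have : FiniteDimensional ℂ (H →L[ℂ] H) := inferInstance
  let tr : (H →L[ℂ] H) →L[ℂ] ℂ :=
    LinearMap.toContinuousLinearMap (LinearMap.trace ℂ H ∘ₗ ContinuousLinearMap.coeLM ℂ)
  have htr (x : G) :
      tr (InnerProductSpace.rankOne ℂ (π.toHom x a') (π.toHom x a)) = inner ℂ a a' :=
    (InnerProductSpace.trace_rankOne _ _).trans ((π.toHom x).inner_map_map a a')
  change tr (averageRankOne μ π π a a') = _
  rw [averageRankOne,
    ← tr.integral_comp_comm (integrable_of_continuous (continuous_rankOne π π a a'))]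
  simp [htr]

theorem inner_toLp_matrixCoeff_self [IsTopologicalGroup G] [μ.IsMulLeftInvariant]
    {π : UnitaryRep G H} (hπ : π.IsIrreducible) (a b a' b' : H) :
    inner ℂ (ContinuousMap.toLp 2 μ ℂ (π.matrixCoeff a b))
      (ContinuousMap.toLp 2 μ ℂ (π.matrixCoeff a' b')) =
      (Module.finrank ℂ H : ℂ)⁻¹ * (inner ℂ a a' * inner ℂ b' b) := by
  have := FiniteDimensional.complete ℂ H
  have := hπ.1
  have hd : (Module.finrank ℂ H : ℂ) ≠ 0 := by exact_mod_cast Module.finrank_pos.ne'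
  obtain ⟨c, hc⟩ := hπ.exists_eq_smul_id (isIntertwining_averageRankOne μ π π a a')
  have htrace : c * Module.finrank ℂ H = inner ℂ a a' := by
    rw [← trace_averageRankOne μ π a a', hc, map_smul, LinearMap.trace_id, smul_eq_mul]
  rw [inner_toLp_matrixCoeff, ← ContinuousLinearMap.coe_coe, hc, LinearMap.smul_apply,
    LinearMap.id_apply, inner_smul_right, ← htrace]
  field_simp

end Orthogonality

section NormalizedCoeff

variable {G : Type u} [Group G] [TopologicalSpace G] [CompactSpace G] [MeasurableSpace G]
  [BorelSpace G] (μ : Measure G) [IsFiniteMeasure μ]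
variable {H : Type v} [NormedAddCommGroup H] [InnerProductSpace ℂ H]

/-- The matrix coefficients multiplied by `√(dim H)`, as elements of `L²(G)`. They are linear in the
first and conjugate-linear in the second vector. -/
noncomputable def normalizedCoeff (π : UnitaryRep G H) : H →ₗ[ℂ] H →ₗ⋆[ℂ] Lp ℂ 2 μ :=
  π.matrixCoeffₛₗ.compr₂ₛₗ
    (((√(Module.finrank ℂ H : ℝ) : ℝ) : ℂ) • (ContinuousMap.toLp 2 μ ℂ).toLinearMap)

lemma normalizedCoeff_apply (π : UnitaryRep G H) (a b : H) :
    π.normalizedCoeff μ a b = ((√(Module.finrank ℂ H : ℝ) : ℝ) : ℂ) •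
      ContinuousMap.toLp 2 μ ℂ (π.matrixCoeff a b) := rfl

lemma toLp_matrixCoeff_mem_of_normalizedCoeff_mem [FiniteDimensional ℂ H] [Nontrivial H]
    {π : UnitaryRep G H} {a b : H} {S : Submodule ℂ (Lp ℂ 2 μ)}
    (h : π.normalizedCoeff μ a b ∈ S) : ContinuousMap.toLp 2 μ ℂ (π.matrixCoeff a b) ∈ S := by
  rw [normalizedCoeff_apply] at h
  refine (S.smul_mem_iff ?_).1 h
  simpa using (Module.finrank_pos (R := ℂ) (M := H)).ne'

lemma normalizedCoeff_mem_of_orthonormalBasis {κ κ' : Type*} [Fintype κ] [Fintype κ']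
    {π : UnitaryRep G H} (e : OrthonormalBasis κ ℂ H) (e' : OrthonormalBasis κ' ℂ H)
    {S : Submodule ℂ (Lp ℂ 2 μ)} (h : ∀ i j, π.normalizedCoeff μ (e i) (e' j) ∈ S) (a b : H) :
    π.normalizedCoeff μ a b ∈ S := by
  rw [← e.sum_repr a, ← e'.sum_repr b]
  simp only [map_sum, LinearMap.sum_apply, map_smul, map_smulₛₗ, LinearMap.smul_apply]
  exact sum_mem fun j _ => S.smul_mem _ (sum_mem fun i _ => S.smul_mem _ (h i j))

variable {μ}

lemma inner_normalizedCoeff_of_not_unitaryEquiv [IsTopologicalGroup G] [μ.IsMulLeftInvariant]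
    {H' : Type v} [NormedAddCommGroup H'] [InnerProductSpace ℂ H']
    [FiniteDimensional ℂ H] [FiniteDimensional ℂ H'] {π : UnitaryRep G H} {π' : UnitaryRep G H'}
    (hπ : π.IsIrreducible) (hπ' : π'.IsIrreducible) (h : ¬ π.UnitaryEquiv π')
    (a b : H) (a' b' : H') :
    inner ℂ (π.normalizedCoeff μ a b) (π'.normalizedCoeff μ a' b') = 0 := by
  rw [normalizedCoeff_apply, normalizedCoeff_apply, inner_smul_left, inner_smul_right,
    inner_toLp_matrixCoeff_of_not_unitaryEquiv μ hπ hπ' h, mul_zero, mul_zero]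

end NormalizedCoeff

section TensorProduct

variable {E F E' F' L M : Type*} [NormedAddCommGroup E] [InnerProductSpace ℂ E]
  [NormedAddCommGroup F] [InnerProductSpace ℂ F] [NormedAddCommGroup L] [InnerProductSpace ℂ L]

variable (E F) in
lemma completeSpace_tensorProduct [FiniteDimensional ℂ E] [FiniteDimensional ℂ F] :
    CompleteSpace (E ⊗[ℂ] F) :=
  FiniteDimensional.complete ℂ (E ⊗[ℂ] F)

variable [NormedAddCommGroup E'] [InnerProductSpace ℂ E'] [NormedAddCommGroup F']
  [InnerProductSpace ℂ F'] [NormedAddCommGroup M] [InnerProductSpace ℂ M]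

lemma inner_map_map_eq_of_tmul {S : E ⊗[ℂ] F →ₗ[ℂ] L} {S' : E' ⊗[ℂ] F' →ₗ[ℂ] L}
    {T : E ⊗[ℂ] F →ₗ[ℂ] M} {T' : E' ⊗[ℂ] F' →ₗ[ℂ] M}
    (h : ∀ a b a' b', inner ℂ (S (a ⊗ₜ b)) (S' (a' ⊗ₜ b')) = inner ℂ (T (a ⊗ₜ b)) (T' (a' ⊗ₜ b')))
    (x : E ⊗[ℂ] F) (y : E' ⊗[ℂ] F') : inner ℂ (S x) (S' y) = inner ℂ (T x) (T' y) := by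
  induction x with
  | zero => simp
  | add x x' hx hx' => simp only [map_add, inner_add_left, hx, hx']
  | tmul a b =>
    induction y with
    | zero => simp
    | add y y' hy hy' => simp only [map_add, inner_add_right, hy, hy']
    | tmul a' b' => exact h a b a' b'

lemma inner_map_map_eq_zero_of_tmul {S : E ⊗[ℂ] F →ₗ[ℂ] L} {S' : E' ⊗[ℂ] F' →ₗ[ℂ] L}
    (h : ∀ a b a' b', inner ℂ (S (a ⊗ₜ b)) (S' (a' ⊗ₜ b')) = 0) (x : E ⊗[ℂ] F)
    (y : E' ⊗[ℂ] F') : inner ℂ (S x) (S' y) = 0 := by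
  simpa using inner_map_map_eq_of_tmul (T := (0 : E ⊗[ℂ] F →ₗ[ℂ] L)) (T' := 0)
    (by simpa using h) x y

/-- The isometry given by a linear map on a tensor product of inner product spaces that preserves
the inner products of pure tensors. -/
noncomputable def isometryOfInnerTmul (T : E ⊗[ℂ] F →ₗ[ℂ] L)
    (h : ∀ a b a' b', inner ℂ (T (a ⊗ₜ b)) (T (a' ⊗ₜ b')) = inner ℂ a a' * inner ℂ b b') :
    E ⊗[ℂ] F →ₗᵢ[ℂ] L :=
  T.isometryOfInner <| inner_map_map_eq_of_tmul (T := LinearMap.id) (T' := LinearMap.id)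
    fun a b a' b' => (h a b a' b').trans (TensorProduct.inner_tmul (𝕜 := ℂ) a a' b b').symm

end TensorProduct

section TensorDual

variable {G : Type u} [Group G] [TopologicalSpace G] [IsTopologicalGroup G] [CompactSpace G]
  [MeasurableSpace G] [BorelSpace G] {μ : Measure G} [IsProbabilityMeasure μ]
  [μ.IsMulLeftInvariant]
variable {H : Type v} [NormedAddCommGroup H] [InnerProductSpace ℂ H] [FiniteDimensional ℂ H]
variable {π : UnitaryRep G H}

lemma inner_normalizedCoeff_self (hπ : π.IsIrreducible) (a b a' b' : H) :
    inner ℂ (π.normalizedCoeff μ a b) (π.normalizedCoeff μ a' b') =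
      inner ℂ a a' * inner ℂ b' b := by
  have := hπ.1
  have hd : (Module.finrank ℂ H : ℂ) ≠ 0 := by exact_mod_cast Module.finrank_pos.ne'
  have hsqrt : ((√(Module.finrank ℂ H : ℝ) : ℝ) : ℂ) * ((√(Module.finrank ℂ H : ℝ) : ℝ) : ℂ) =
      Module.finrank ℂ H := by
    rw [← Complex.ofReal_mul, Real.mul_self_sqrt (Nat.cast_nonneg _), Complex.ofReal_natCast]
  rw [normalizedCoeff_apply, normalizedCoeff_apply, inner_smul_left, inner_smul_right,
    inner_toLp_matrixCoeff_self μ hπ, Complex.conj_ofReal, ← mul_assoc, ← mul_assoc, hsqrt,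
    mul_inv_cancel₀ hd, one_mul]

lemma orthonormal_normalizedCoeff (hπ : π.IsIrreducible) {κ κ' : Type*} {e : κ → H} {e' : κ' → H}
    (he : Orthonormal ℂ e) (he' : Orthonormal ℂ e') :
    Orthonormal ℂ fun p : κ × κ' => π.normalizedCoeff μ (e p.1) (e' p.2) := by
  classical
  rw [orthonormal_iff_ite] at he he' ⊢
  rintro ⟨i, j⟩ ⟨k, l⟩
  simp only [inner_normalizedCoeff_self hπ, he, he', Prod.mk.injEq, eq_comm (a := l), ite_and]
  split_ifs <;> simp

variable [CompleteSpace H]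

variable (μ) in
/-- The isometry `H ⊗ H* → L²(G)` that sends `a ⊗ ⟨·, b⟩` to the normalized matrix coefficient of
`a` and `b`. -/
noncomputable def tensorDualIsometry (hπ : π.IsIrreducible) :
    H ⊗[ℂ] StrongDual ℂ H →ₗᵢ[ℂ] Lp ℂ 2 μ :=
  isometryOfInnerTmul (F := StrongDual ℂ H)
    (TensorProduct.lift ((π.normalizedCoeff μ).compl₂
      (InnerProductSpace.toDual ℂ H).symm.toLinearEquiv.toLinearMap))
    fun a _ a' _ => inner_normalizedCoeff_self hπ a _ a' _

lemma tensorDualIsometry_tmul (hπ : π.IsIrreducible) (a : H) (φ : StrongDual ℂ H) :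
    tensorDualIsometry μ hπ (a ⊗ₜ φ) =
      π.normalizedCoeff μ a ((InnerProductSpace.toDual ℂ H).symm φ) := rfl

lemma tensorDualIsometry_tmul_toDual (hπ : π.IsIrreducible) (a b : H) :
    tensorDualIsometry μ hπ (a ⊗ₜ InnerProductSpace.toDual ℂ H b) = π.normalizedCoeff μ a b := by
  rw [tensorDualIsometry_tmul, LinearIsometryEquiv.symm_apply_apply]

lemma inner_tensorDualIsometry_of_not_unitaryEquiv {H' : Type v} [NormedAddCommGroup H']
    [InnerProductSpace ℂ H'] [FiniteDimensional ℂ H'] [CompleteSpace H'] {π' : UnitaryRep G H'}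
    (hπ : π.IsIrreducible) (hπ' : π'.IsIrreducible) (h : ¬ π.UnitaryEquiv π')
    (x : H ⊗[ℂ] StrongDual ℂ H) (y : H' ⊗[ℂ] StrongDual ℂ H') :
    inner ℂ (tensorDualIsometry μ hπ x) (tensorDualIsometry μ hπ' y) = 0 :=
  inner_map_map_eq_zero_of_tmul (F := StrongDual ℂ H) (F' := StrongDual ℂ H')
    (S := (tensorDualIsometry μ hπ).toLinearMap) (S' := (tensorDualIsometry μ hπ').toLinearMap)
    (fun _ _ _ _ => inner_normalizedCoeff_of_not_unitaryEquiv hπ hπ' h _ _ _ _) x y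

end TensorDual

section PeterWeyl

variable {G : Type u} [Group G] [TopologicalSpace G]

instance (σ : IrredUnitaryRep.{u, v} G) : Nontrivial σ.space :=
  σ.irreducible.1

variable {ι : Type*} {R : ι → IrredUnitaryRep.{u, v} G}

lemma matrixCoeffSpan_le_of_surjective_toUnitaryDual
    (hR : Function.Surjective fun i => (R i).toUnitaryDual) {S : Submodule ℂ C(G, ℂ)}
    (hS : ∀ i a b, (R i).rep.matrixCoeff a b ∈ S) : matrixCoeffSpan.{u, v} G ≤ S := by
  refine Submodule.span_le.2 ?_
  rintro _ ⟨V, _, _, _, π, a, b, rfl⟩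
  refine Submodule.span_le.2 ?_ (π.matrixCoeff_mem_span_irreducible a b)
  rintro _ ⟨τ, c, d, rfl⟩
  obtain ⟨i, hi⟩ := hR τ.toUnitaryDual
  obtain ⟨T, hT⟩ : τ.rep.UnitaryEquiv (R i).rep := Quotient.exact hi.symm
  exact matrixCoeff_map_of_isIntertwining T hT c d ▸ hS i _ _

lemma not_unitaryEquiv_of_injective_toUnitaryDual
    (hR : Function.Injective fun i => (R i).toUnitaryDual) {i j : ι} (hij : i ≠ j) :
    ¬ (R i).rep.UnitaryEquiv (R j).rep :=
  fun h => hij (hR (Quotient.sound h))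

variable [IsTopologicalGroup G] [CompactSpace G]

instance (σ : IrredUnitaryRep.{u, v} G) : FiniteDimensional ℂ σ.space :=
  σ.irreducible.finiteDimensional

variable [MeasurableSpace G] [BorelSpace G] {μ : Measure G}

theorem topologicalClosure_eq_top_of_normalizedCoeff_mem [IsFiniteMeasure μ] [T2Space G]
    [μ.Regular] (hR : Function.Surjective fun i => (R i).toUnitaryDual)
    {S : Submodule ℂ (Lp ℂ 2 μ)} (hS : ∀ i a b, (R i).rep.normalizedCoeff μ a b ∈ S) :
    S.topologicalClosure = ⊤ := by
  have hdense := (ContinuousMap.toLp_denseRange ℂ μ ℂ (p := 2) (by simp)).dense_image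
    (ContinuousMap.toLp 2 μ ℂ).continuous dense_matrixCoeffSpan.{u, v}
  have hsub : matrixCoeffSpan.{u, v} G ≤ S.comap (ContinuousMap.toLp 2 μ ℂ).toLinearMap :=
    matrixCoeffSpan_le_of_surjective_toUnitaryDual hR fun i a b =>
      toLp_matrixCoeff_mem_of_normalizedCoeff_mem μ (hS i a b)
  exact Submodule.dense_iff_topologicalClosure_eq_top.1 (hdense.mono (Set.image_subset_iff.2 hsub))

variable [IsProbabilityMeasure μ] [μ.IsMulLeftInvariant]

theorem orthonormal_normalizedCoeff_of_injective_toUnitaryDual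
    (hR : Function.Injective fun i => (R i).toUnitaryDual) {κ : ι → Type*}
    {e : ∀ i, κ i → (R i).space} (he : ∀ i, Orthonormal ℂ (e i)) :
    Orthonormal ℂ fun p : Σ i, κ i × κ i =>
      (R p.1).rep.normalizedCoeff μ (e p.1 p.2.1) (e p.1 p.2.2) := by
  have hself (i : ι) := orthonormal_normalizedCoeff (μ := μ) (R i).irreducible (he i) (he i)
  refine ⟨fun ⟨i, p⟩ => (hself i).1 p, ?_⟩
  rintro ⟨i, p⟩ ⟨j, q⟩ hne
  obtain rfl | hij := eq_or_ne i j
  · exact (hself i).2 fun h => hne (congrArg (Sigma.mk i) h)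
  · exact inner_normalizedCoeff_of_not_unitaryEquiv (R i).irreducible (R j).irreducible
      (not_unitaryEquiv_of_injective_toUnitaryDual hR hij) _ _ _ _

variable [T2Space G] [μ.Regular]

variable (μ) in
/-- The Hilbert basis of `L²(G)` formed by the normalized matrix coefficients with respect to
orthonormal bases of representatives of the unitary dual. -/
noncomputable def coeffHilbertBasis (hR : Function.Bijective fun i => (R i).toUnitaryDual)
    {κ : ι → Type*} [∀ i, Fintype (κ i)] (e : ∀ i, OrthonormalBasis (κ i) ℂ (R i).space) :
    HilbertBasis (Σ i, κ i × κ i) ℂ (Lp ℂ 2 μ) :=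
  HilbertBasis.mk
    (orthonormal_normalizedCoeff_of_injective_toUnitaryDual hR.1 fun i => (e i).orthonormal)
    (topologicalClosure_eq_top_of_normalizedCoeff_mem hR.2 fun i =>
      normalizedCoeff_mem_of_orthonormalBasis μ (e i) (e i) fun j k =>
        Submodule.subset_span (Set.mem_range_self (⟨i, j, k⟩ : Σ i, κ i × κ i))).ge

lemma coeffHilbertBasis_apply (hR : Function.Bijective fun i => (R i).toUnitaryDual)
    {κ : ι → Type*} [∀ i, Fintype (κ i)] (e : ∀ i, OrthonormalBasis (κ i) ℂ (R i).space)
    (i : ι) (j k : κ i) :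
    coeffHilbertBasis μ hR e ⟨i, j, k⟩ = (R i).rep.normalizedCoeff μ (e i j) (e i k) := by
  rw [coeffHilbertBasis, HilbertBasis.coe_mk]

theorem isHilbertSum_tensorDualIsometry
    (hR : Function.Bijective fun i => (R i).toUnitaryDual) :
    IsHilbertSum ℂ (fun i => (R i).space ⊗[ℂ] StrongDual ℂ (R i).space)
      fun i => tensorDualIsometry μ (R i).irreducible := by
  have hcomplete (i : ι) : CompleteSpace ((R i).space ⊗[ℂ] StrongDual ℂ (R i).space) :=
    completeSpace_tensorProduct (R i).space (StrongDual ℂ (R i).space)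
  refine IsHilbertSum.mk (fun i j hij => ?_)
    (topologicalClosure_eq_top_of_normalizedCoeff_mem hR.2 fun i a b => ?_).ge
  · exact inner_tensorDualIsometry_of_not_unitaryEquiv (R i).irreducible (R j).irreducible
      (not_unitaryEquiv_of_injective_toUnitaryDual hR.1 hij)
  · rw [← tensorDualIsometry_tmul_toDual (R i).irreducible]
    exact Submodule.mem_iSup_of_mem i ⟨_, rfl⟩

end PeterWeyl

end UnitaryRep

open UnitaryRep

theorem theoremA1 {G : Type u} [Group G] [TopologicalSpace G] [IsTopologicalGroup G]
    [CompactSpace G] [T2Space G] [MeasurableSpace G] [BorelSpace G]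
    (μ : Measure G) [μ.IsHaarMeasure] [IsProbabilityMeasure μ] [μ.Regular] :
    -- every finite-dimensional continuous representation is equivalent to a unitary one
    (∀ (V : Type v) [AddCommGroup V] [Module ℂ V] [TopologicalSpace V] [IsTopologicalAddGroup V]
        [ContinuousSMul ℂ V] [T2Space V] [FiniteDimensional ℂ V] (ρ : Representation ℂ G V),
      (∀ a : V, Continuous fun g : G => ρ g a) →
      ∃ (H : Type v) (_ : NormedAddCommGroup H) (_ : InnerProductSpace ℂ H)
        (_ : FiniteDimensional ℂ H) (π : UnitaryRep G H) (T : V ≃L[ℂ] H),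
        ∀ (g : G) (a : V), T (ρ g a) = π.toHom g (T a)) ∧
    -- the span of the matrix coefficients
    (∃ A : StarSubalgebra ℂ C(G, ℂ),
      (A : Set C(G, ℂ)) = matrixCoeffSpan.{u, v} G ∧
      (∀ c : ℂ, ContinuousMap.const G c ∈ A) ∧
      A.toSubalgebra.SeparatesPoints ∧
      ∀ (f : C(G, ℂ)) (ε : ℝ), 0 < ε → ∃ a ∈ A, ∀ x : G, ‖f x - a x‖ < ε) ∧
    -- irreducible unitary representations are finite-dimensional
    (∀ σ : IrredUnitaryRep.{u, v} G, FiniteDimensional ℂ σ.space) ∧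
    -- for each choice of representatives of the unitary dual
    (∀ R : UnitaryDual.{u, v} G → IrredUnitaryRep.{u, v} G, (∀ σ, (R σ).toUnitaryDual = σ) →
      -- the normalized matrix coefficients form an orthonormal basis
      (∀ (n : UnitaryDual.{u, v} G → ℕ)
          (e : ∀ σ, OrthonormalBasis (Fin (n σ)) ℂ (R σ).space),
        ∃ B : HilbertBasis (Σ σ : UnitaryDual.{u, v} G, Fin (n σ) × Fin (n σ)) ℂ (Lp ℂ 2 μ),
          ∀ (σ : UnitaryDual.{u, v} G) (i j : Fin (n σ)),
            B ⟨σ, (i, j)⟩ = ((√(Module.finrank ℂ (R σ).space : ℝ) : ℝ) : ℂ) •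
              ContinuousMap.toLp 2 μ ℂ ((R σ).rep.matrixCoeff (e σ i) (e σ j))) ∧
      -- the Hilbert direct sum decomposition, through the normalized matrix coefficients
      (letI := Classical.decEq (UnitaryDual.{u, v} G)
      ∃ U : lp (fun σ : UnitaryDual.{u, v} G =>
          (R σ).space ⊗[ℂ] StrongDual ℂ (R σ).space) 2 ≃ₗᵢ[ℂ] Lp ℂ 2 μ,
        ∀ (σ : UnitaryDual.{u, v} G) (a b : (R σ).space),
          U (lp.single 2 σ (a ⊗ₜ[ℂ] InnerProductSpace.toDual ℂ (R σ).space b)) =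
            ((√(Module.finrank ℂ (R σ).space : ℝ) : ℝ) : ℂ) •
              ContinuousMap.toLp 2 μ ℂ ((R σ).rep.matrixCoeff a b))) := by
  refine ⟨fun V _ _ _ _ _ _ _ ρ hρ => exists_unitaryRep ρ hρ,
    ⟨matrixCoeffStarSubalgebra G, coe_matrixCoeffStarSubalgebra, fun c => algebraMap_mem _ c,
      separatesPoints_matrixCoeffStarSubalgebra, fun f ε hε => ?_⟩,
    fun σ => inferInstance, fun R hR => ?_⟩
  · obtain ⟨a, ha, hfa⟩ := dense_matrixCoeffSpan.exists_dist_lt f hε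
    exact ⟨a, ha, fun x => (dist_eq_norm (f x) (a x)).symm.trans_lt
      ((ContinuousMap.dist_apply_le_dist x).trans_lt hfa)⟩
  have hbij : Function.Bijective fun σ => (R σ).toUnitaryDual :=
    (funext hR : (fun σ => (R σ).toUnitaryDual) = id) ▸ Function.bijective_id
  refine ⟨fun n e => ⟨coeffHilbertBasis μ hbij e, coeffHilbertBasis_apply hbij e⟩, ?_⟩
  classical
  have hsum := isHilbertSum_tensorDualIsometry (μ := μ) hbij
  exact ⟨hsum.linearIsometryEquiv.symm, fun σ a b =>
    (hsum.linearIsometryEquiv_symm_apply_single _).trans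
      (tensorDualIsometry_tmul_toDual (R σ).irreducible a b)⟩
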